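/- Let $N\ge 0$ be an integer and let $\mathbb H_N$ be the real Hilbert space of $N\times N$ complex Hermitian matrices with the Frobenius norm. For $X\in\mathbb H_N$ let $\lambda(X)\in\mathbb R^N$ be the vector of its eigenvalues, counted with multiplicity and ordered non-increasingly. For a Hilbert space $\mathcal H$, a function $g:\mathcal H\to[-\infty,\infty]$ and a number $\gamma\ge 0$, the quadratic envelope of $g$ is $$\mathcal Q_\gamma(g)(x)=\sup\Big\{\alpha-\tfrac{\gamma}{2}\|x-y\|^2 \;:\; \alpha\in\mathbb R,\ y\in\mathcal H,\ \alpha-\tfrac{\gamma}{2}\|\cdot-y\|^2\le g\Big\},$$ and the proximal operator of $g$ is the set-valued map $$\operatorname{prox}_g(w)=\operatorname*{argmin}_{v\in\mathcal H}\Big(g(v)+\tfrac12\|v-w\|^2\Big).$$ Let $\mathbb R^N$ carry the Euclidean norm, let $f:\mathbb R^N\to[0,\infty]$ be symmetric, that is, invariant under permutations of the coordinates, and define $F:\mathbb H_N\to[0,\infty]$ by $F(X)=f(\lambda(X))$. Let $\gamma\ge 0$. Then $$\mathcal Q_\gamma(F)=\mathcal Q_\gamma(f)\circ\lambda .$$ Moreover,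 if $f$ is not identically $+\infty$, then for every $\rho>\gamma$ and every $X\in\mathbb H_N$ the set $\operatorname{prox}_{\mathcal Q_\gamma(f)/\rho}(\lambda(X))$ has exactly one element, and for every unitary matrix $U$ such that $X=U\operatorname{diag}(\lambda(X))U^*$, $$\operatorname{prox}_{\mathcal Q_\gamma(F)/\rho}(X)=U\operatorname{diag}\big(\operatorname{prox}_{\mathcal Q_\gamma(f)/\rho}(\lambda(X))\big)U^*$$ (an equality of sets, each consisting of a single matrix). -/

import Mathlib

open scoped ENNReal

-- Matrices carry the Frobenius norm.
attribute [local instance] Matrix.frobeniusNormedAddCommGroup Matrix.frobeniusNormedSpace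

noncomputable section

/-- The quadratic envelope of an extended-real-valued function `f`: the supremum of all quadratic
minorants `α - γ / 2 * ‖· - y‖ ^ 2` of `f`. -/
def quadraticEnvelope {H : Type*} [NormedAddCommGroup H] (γ : ℝ) (f : H → EReal) (x : H) : EReal :=
  ⨆ (α : ℝ) (y : H) (_ : ∀ z : H, ((α - γ / 2 * ‖z - y‖ ^ 2 : ℝ) : EReal) ≤ f z),
    ((α - γ / 2 * ‖x - y‖ ^ 2 : ℝ) : EReal)

/-- The (possibly empty or set-valued) proximal operator: the set of all minimizers of
`v ↦ g v + 1 / 2 * ‖v - w‖ ^ 2`. -/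
def prox {H : Type*} [NormedAddCommGroup H] (g : H → EReal) (w : H) : Set H :=
  {v | ∀ u : H, g v + ((1 / 2 * ‖v - w‖ ^ 2 : ℝ) : EReal)
    ≤ g u + ((1 / 2 * ‖u - w‖ ^ 2 : ℝ) : EReal)}

/-- The space of `N × N` complex Hermitian matrices, with the Frobenius norm. -/
abbrev HermMat (N : ℕ) : Type := selfAdjoint (Matrix (Fin N) (Fin N) ℂ)

/-- The vector of eigenvalues of a Hermitian matrix, with multiplicity, ordered non-increasingly. -/
def eigvals {N : ℕ} (X : HermMat N) : EuclideanSpace ℝ (Fin N) :=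
  WithLp.toLp 2 fun i =>
    Matrix.IsHermitian.eigenvalues₀ (A := (X : Matrix (Fin N) (Fin N) ℂ)) X.2
      (Fin.cast (Fintype.card_fin N).symm i)

/-- The Hermitian matrix `U diag(v) U*`. -/
def conjDiag {N : ℕ} (U : Matrix.unitaryGroup (Fin N) ℂ) (v : EuclideanSpace ℝ (Fin N)) :
    HermMat N :=
  ⟨(U : Matrix (Fin N) (Fin N) ℂ) * Matrix.diagonal (fun i => ((v i : ℝ) : ℂ)) *
      star (U : Matrix (Fin N) (Fin N) ℂ), by
    have h : star (Matrix.diagonal (fun i => ((v i : ℝ) : ℂ))) =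
        Matrix.diagonal (fun i => ((v i : ℝ) : ℂ)) := by
      rw [Matrix.star_eq_conjTranspose, Matrix.diagonal_conjTranspose]
      congr 1
      funext i
      simp
    rw [selfAdjoint.mem_iff, star_mul, star_mul, star_star, h, mul_assoc]⟩

/-- A function on `ℝ^N` is symmetric if it is invariant under permutations of the coordinates. -/
def IsSymmetricFun {N : ℕ} (f : EuclideanSpace ℝ (Fin N) → ℝ≥0∞) : Prop :=
  ∀ (σ : Equiv.Perm (Fin N)) (x : EuclideanSpace ℝ (Fin N)),
    f (WithLp.toLp 2 fun i => x (σ i)) = f x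

end

/-! ### Quadratic envelopes and proximal points -/

section Envelope

variable {H : Type*} [NormedAddCommGroup H] {γ : ℝ} {f : H → EReal}

/-! Everything rests on the Hoffman–Wielandt inequality `norm_eigvals_sub_eigvals_le`, with equality
for two matrices diagonalized compatibly by one unitary. It lets quadratic minorants pass between
`F` and `f`: a center `Y` goes down to its eigenvalue vector, and a center `y` goes up to `conjDiag
U y`, where `U` diagonalizes the evaluation point. Symmetry of `f` absorbs the lost ordering of
coordinates.

For the proximal points, the envelope plus `γ / 2 * ‖·‖ ^ 2` is midpoint convex, so for `ρ > γ` the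
objective has at most one minimizer, on vectors and on matrices alike. Compactness gives a minimizer
on vectors; Hoffman–Wielandt makes its lift a minimizer on matrices, hence the only one. -/

theorem quadraticEnvelope_le_iff {x : H} {c : EReal} :
    quadraticEnvelope γ f x ≤ c ↔
      ∀ (α : ℝ) (y : H), (∀ z : H, ((α - γ / 2 * ‖z - y‖ ^ 2 : ℝ) : EReal) ≤ f z) →
        ((α - γ / 2 * ‖x - y‖ ^ 2 : ℝ) : EReal) ≤ c := by
  simp only [quadraticEnvelope, iSup_le_iff]

theorem le_quadraticEnvelope {α : ℝ} {y : H}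
    (h : ∀ z : H, ((α - γ / 2 * ‖z - y‖ ^ 2 : ℝ) : EReal) ≤ f z) (x : H) :
    ((α - γ / 2 * ‖x - y‖ ^ 2 : ℝ) : EReal) ≤ quadraticEnvelope γ f x :=
  quadraticEnvelope_le_iff.1 le_rfl α y h

theorem quadraticEnvelope_le (x : H) : quadraticEnvelope γ f x ≤ f x :=
  quadraticEnvelope_le_iff.2 fun _ _ h => h x

theorem quadraticEnvelope_nonneg (hγ : 0 ≤ γ) (hf : ∀ x, 0 ≤ f x) (x : H) :
    0 ≤ quadraticEnvelope γ f x := by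
  have h := le_quadraticEnvelope (γ := γ) (f := f) (α := 0) (y := x) (fun z => by
    refine le_trans ?_ (hf z)
    have : 0 ≤ γ / 2 * ‖z - x‖ ^ 2 := by positivity
    exact_mod_cast (by linarith : (0 - γ / 2 * ‖z - x‖ ^ 2 : ℝ) ≤ 0)) x
  simpa using h

theorem lowerSemicontinuous_quadraticEnvelope :
    LowerSemicontinuous (quadraticEnvelope γ f) := by
  unfold quadraticEnvelope
  refine lowerSemicontinuous_iSup fun α => lowerSemicontinuous_iSup fun y =>
    lowerSemicontinuous_iSup fun _ => Continuous.lowerSemicontinuous ?_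
  exact continuous_coe_real_ereal.comp (by fun_prop)

/-- A nonnegative proper lower semicontinuous function on a proper space has proximal points. -/
theorem exists_mem_prox [ProperSpace H] {g : H → EReal} (hg : LowerSemicontinuous g)
    (hg0 : ∀ x, 0 ≤ g x) {x₀ : H} (hx₀ : g x₀ ≠ ⊤) (w : H) : ∃ v, v ∈ prox g w := by
  set h : H → EReal := fun v => g v + ((1 / 2 * ‖v - w‖ ^ 2 : ℝ) : EReal) with hh
  have hlsc : LowerSemicontinuous h := by
    refine LowerSemicontinuous.add' hg (Continuous.lowerSemicontinuous
      (continuous_coe_real_ereal.comp (by fun_prop))) fun x => EReal.continuousAt_add ?_ ?_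
    · exact Or.inr (EReal.coe_ne_bot _)
    · exact Or.inr (EReal.coe_ne_top _)
  lift g x₀ to ℝ using ⟨hx₀, ((EReal.bot_lt_zero).trans_le (hg0 x₀)).ne'⟩ with c hc
  have hc0 : 0 ≤ c := by have := hg0 x₀; rw [← hc] at this; exact_mod_cast this
  -- Outside the ball of radius `√r`, the quadratic term alone is at least the objective at `x₀`.
  set r : ℝ := 2 * c + ‖x₀ - w‖ ^ 2 with hr
  have hr0 : 0 ≤ r := by positivity
  have hx₀mem : x₀ ∈ Metric.closedBall w (√r) := by
    rw [mem_closedBall_iff_norm]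
    exact Real.le_sqrt_of_sq_le (by linarith)
  obtain ⟨v, -, hv⟩ := LowerSemicontinuousOn.exists_isMinOn ⟨x₀, hx₀mem⟩
    (isCompact_closedBall w (√r)) (hlsc.lowerSemicontinuousOn _)
  rw [isMinOn_iff] at hv
  refine ⟨v, fun u => ?_⟩
  by_cases hu : u ∈ Metric.closedBall w (√r)
  · exact hv u hu
  · refine (hv x₀ hx₀mem).trans ?_
    rw [mem_closedBall_iff_norm, not_le] at hu
    have hu2 : r ≤ ‖u - w‖ ^ 2 := (Real.lt_sq_of_sqrt_lt hu).le
    have h1 : h x₀ ≤ ((1 / 2 * ‖u - w‖ ^ 2 : ℝ) : EReal) := by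
      simp only [hh, ← hc]
      exact_mod_cast (by linarith : c + 1 / 2 * ‖x₀ - w‖ ^ 2 ≤ 1 / 2 * ‖u - w‖ ^ 2)
    exact h1.trans (le_add_of_nonneg_left (hg0 u))

/-- The parallelogram law is a hypothesis because the Frobenius norm enters here without an inner
product structure. -/
theorem norm_sq_midpoint_sub [NormedSpace ℝ H]
    (hpar : ∀ x y : H, ‖x + y‖ ^ 2 + ‖x - y‖ ^ 2 = 2 * (‖x‖ ^ 2 + ‖y‖ ^ 2)) (a b y : H) :
    ‖(1 / 2 : ℝ) • (a + b) - y‖ ^ 2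
      = ‖a - y‖ ^ 2 / 2 + ‖b - y‖ ^ 2 / 2 - ‖a - b‖ ^ 2 / 4 := by
  have h := hpar (a - y) (b - y)
  have h1 : (a - y) + (b - y) = (2 : ℝ) • ((1 / 2 : ℝ) • (a + b) - y) := by
    module
  rw [h1, norm_smul, sub_sub_sub_cancel_right] at h
  simp only [Real.norm_ofNat] at h
  linarith

theorem coe_add_half_norm_sq_le {a b : EReal} {x y : ℝ} {s t : ℝ}
    (ha : a = x) (hb : b = y) (h : a + ((s : ℝ) : EReal) ≤ b + ((t : ℝ) : EReal)) :
    x + s ≤ y + t := by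
  rw [ha, hb] at h
  exact_mod_cast h

/-- All quadratic minorants have the same curvature `-γ`, so each satisfies this bound, and it
survives the supremum. -/
theorem quadraticEnvelope_midpoint_le [NormedSpace ℝ H]
    (hpar : ∀ x y : H, ‖x + y‖ ^ 2 + ‖x - y‖ ^ 2 = 2 * (‖x‖ ^ 2 + ‖y‖ ^ 2)) {a b : H} {A B : ℝ}
    (hA : quadraticEnvelope γ f a = A) (hB : quadraticEnvelope γ f b = B) :
    quadraticEnvelope γ f ((1 / 2 : ℝ) • (a + b))
      ≤ ((A / 2 + B / 2 + γ / 8 * ‖a - b‖ ^ 2 : ℝ) : EReal) := by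
  refine quadraticEnvelope_le_iff.2 fun α y h => ?_
  have h1 : α - γ / 2 * ‖a - y‖ ^ 2 ≤ A := by
    have := le_quadraticEnvelope h a
    rw [hA] at this
    exact_mod_cast this
  have h2 : α - γ / 2 * ‖b - y‖ ^ 2 ≤ B := by
    have := le_quadraticEnvelope h b
    rw [hB] at this
    exact_mod_cast this
  rw [EReal.coe_le_coe_iff, norm_sq_midpoint_sub hpar]
  linarith

theorem prox_quadraticEnvelope_subsingleton [NormedSpace ℝ H]
    (hpar : ∀ x y : H, ‖x + y‖ ^ 2 + ‖x - y‖ ^ 2 = 2 * (‖x‖ ^ 2 + ‖y‖ ^ 2))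
    (hγ : 0 ≤ γ) (hf : ∀ x, 0 ≤ f x) {x₀ : H} (hx₀ : f x₀ ≠ ⊤) {ρ : ℝ} (hρ : γ < ρ) (w : H) :
    (prox (fun x => quadraticEnvelope γ f x / (ρ : EReal)) w).Subsingleton := by
  have hρ0 : 0 < ρ := hγ.trans_lt hρ
  have hbot : ∀ x, quadraticEnvelope γ f x ≠ ⊥ := fun x =>
    (EReal.bot_lt_zero.trans_le (quadraticEnvelope_nonneg hγ hf x)).ne'
  obtain ⟨c, hc⟩ : ∃ c : ℝ, quadraticEnvelope γ f x₀ = c :=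
    ⟨_, (EReal.coe_toReal ((quadraticEnvelope_le x₀).trans_lt hx₀.lt_top).ne (hbot x₀)).symm⟩
  -- Comparison with `x₀` keeps the envelope finite at minimizers, so the rest is real arithmetic.
  have hfin : ∀ a ∈ prox (fun x => quadraticEnvelope γ f x / (ρ : EReal)) w,
      ∃ A : ℝ, quadraticEnvelope γ f a = A := by
    intro a ha
    refine ⟨_, (EReal.coe_toReal (fun htop => ?_) (hbot a)).symm⟩
    have h := ha x₀
    simp only [hc, htop, ← EReal.coe_div] at h
    rw [EReal.top_div_of_pos_ne_top (by exact_mod_cast hρ0) (EReal.coe_ne_top _),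
      EReal.top_add_coe, top_le_iff, ← EReal.coe_add] at h
    exact EReal.coe_ne_top _ h
  intro a ha b hb
  obtain ⟨A, hA⟩ := hfin a ha
  obtain ⟨B, hB⟩ := hfin b hb
  have hm := quadraticEnvelope_midpoint_le hpar hA hB
  obtain ⟨M, hM⟩ : ∃ M : ℝ, quadraticEnvelope γ f ((1 / 2 : ℝ) • (a + b)) = M :=
    ⟨_, (EReal.coe_toReal (hm.trans_lt (EReal.coe_lt_top _)).ne (hbot _)).symm⟩
  rw [hM, EReal.coe_le_coe_iff] at hm
  have h1 := coe_add_half_norm_sq_le (x := A / ρ) (y := M / ρ)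
    (by simp only [hA, EReal.coe_div]) (by simp only [hM, EReal.coe_div]) (ha ((1 / 2 : ℝ) • (a + b)))
  have h2 := coe_add_half_norm_sq_le (x := B / ρ) (y := M / ρ)
    (by simp only [hB, EReal.coe_div]) (by simp only [hM, EReal.coe_div]) (hb ((1 / 2 : ℝ) • (a + b)))
  rw [norm_sq_midpoint_sub hpar] at h1 h2
  have h3 : M / ρ ≤ A / ρ / 2 + B / ρ / 2 + γ / ρ / 8 * ‖a - b‖ ^ 2 := by
    calc M / ρ ≤ (A / 2 + B / 2 + γ / 8 * ‖a - b‖ ^ 2) / ρ := by gcongr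
      _ = _ := by ring
  have h4 : γ / ρ < 1 := (div_lt_one hρ0).2 hρ
  have h5 : (1 - γ / ρ) * ‖a - b‖ ^ 2 ≤ 0 := by linarith
  have h6 : ‖a - b‖ ^ 2 ≤ 0 := by
    by_contra! hpos
    exact absurd h5 (not_le.2 (mul_pos (sub_pos.2 h4) hpos))
  have h7 : ‖a - b‖ = 0 := by
    exact pow_eq_zero_iff two_ne_zero |>.1 (le_antisymm h6 (sq_nonneg _))
  exact sub_eq_zero.1 (norm_eq_zero.1 h7)

theorem exists_mem_prox_quadraticEnvelope [ProperSpace H]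
    (hγ : 0 ≤ γ) (hf : ∀ x, 0 ≤ f x) {x₀ : H} (hx₀ : f x₀ ≠ ⊤) {ρ : ℝ} (hρ : 0 < ρ) (w : H) :
    ∃ v, v ∈ prox (fun x => quadraticEnvelope γ f x / (ρ : EReal)) w := by
  have hρ0 : (0 : EReal) < ρ := by exact_mod_cast hρ
  refine exists_mem_prox (x₀ := x₀) ?_ (fun x => EReal.div_nonneg
    (quadraticEnvelope_nonneg hγ hf x) hρ0.le) (fun h => ?_) w
  · intro x y hy
    change y < quadraticEnvelope γ f x / (ρ : EReal) at hy
    rw [EReal.lt_div_iff hρ0 (EReal.coe_ne_top _)] at hy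
    filter_upwards [lowerSemicontinuous_quadraticEnvelope x _ hy] with z hz
    exact (EReal.lt_div_iff hρ0 (EReal.coe_ne_top _)).2 hz
  · have h1 := (quadraticEnvelope_le (γ := γ) (f := f) x₀).trans_lt hx₀.lt_top
    have h2 := (EReal.div_eq_iff (EReal.coe_ne_bot _) (EReal.coe_ne_top _) hρ0.ne').1 h
    rw [EReal.top_mul_of_pos hρ0] at h2
    exact h1.ne h2

end Envelope

/-! ### Frobenius norm and spectral decomposition -/

section Spectral

variable {N : ℕ}

theorem Matrix.frobenius_norm_sq_eq_sum {n : Type*} [Fintype n] (A : Matrix n n ℂ) :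
    ‖A‖ ^ 2 = ∑ i, ∑ j, ‖A i j‖ ^ 2 := by
  rw [Matrix.frobenius_norm_def, ← Real.sqrt_eq_rpow, Real.sq_sqrt (by positivity)]
  simp

theorem Matrix.frobenius_norm_sq_eq_trace {n : Type*} [Fintype n] (A : Matrix n n ℂ) :
    ((‖A‖ ^ 2 : ℝ) : ℂ) = (star A * A).trace := by
  rw [Matrix.frobenius_norm_sq_eq_sum, Finset.sum_comm]
  push_cast
  simp only [Matrix.trace, Matrix.diag, Matrix.mul_apply, Matrix.star_apply]
  refine Finset.sum_congr rfl fun i _ => Finset.sum_congr rfl fun j _ => ?_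
  exact (RCLike.conj_mul (A j i)).symm

theorem Matrix.frobenius_norm_unitary_mul_mul {n : Type*} [Fintype n] [DecidableEq n]
    (U V : Matrix.unitaryGroup n ℂ) (A : Matrix n n ℂ) :
    ‖(U : Matrix n n ℂ) * A * (V : Matrix n n ℂ)‖ = ‖A‖ := by
  have hU : star (U : Matrix n n ℂ) * U = 1 := Unitary.coe_star_mul_self U
  have hV : (V : Matrix n n ℂ) * star (V : Matrix n n ℂ) = 1 := Unitary.coe_mul_star_self V
  refine (sq_eq_sq₀ (norm_nonneg _) (norm_nonneg _)).1 ?_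
  have h : ((‖(U : Matrix n n ℂ) * A * (V : Matrix n n ℂ)‖ ^ 2 : ℝ) : ℂ) = ((‖A‖ ^ 2 : ℝ) : ℂ) := by
    rw [Matrix.frobenius_norm_sq_eq_trace, Matrix.frobenius_norm_sq_eq_trace]
    calc _ = (star (V : Matrix n n ℂ) * (star A * (star (U : Matrix n n ℂ) * U) * A * V)).trace := by
          simp only [star_mul, mul_assoc]
      _ = _ := by rw [hU, Matrix.trace_mul_comm, mul_one, mul_assoc, hV, mul_one]
  exact_mod_cast h

theorem HermMat.norm_eq (X : HermMat N) : ‖X‖ = ‖(X : Matrix (Fin N) (Fin N) ℂ)‖ := rfl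

theorem HermMat.parallelogram (X Y : HermMat N) :
    ‖X + Y‖ ^ 2 + ‖X - Y‖ ^ 2 = 2 * (‖X‖ ^ 2 + ‖Y‖ ^ 2) := by
  simp only [HermMat.norm_eq, Matrix.frobenius_norm_sq_eq_sum, AddSubgroup.coe_add,
    AddSubgroup.coe_sub, Matrix.add_apply, Matrix.sub_apply]
  simp only [← Finset.sum_add_distrib, Finset.mul_sum]
  refine Finset.sum_congr rfl fun i _ => Finset.sum_congr rfl fun j _ => ?_
  have := parallelogram_law_with_norm ℝ ((X : Matrix (Fin N) (Fin N) ℂ) i j)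
    ((Y : Matrix (Fin N) (Fin N) ℂ) i j)
  linarith

/-- With `W = U* V`, multiplying by `U*` on the left and `V` on the right preserves the norm and
leaves the entries `W i j * (a i - b j)`. -/
theorem norm_conjDiag_sub_conjDiag_sq (U V : Matrix.unitaryGroup (Fin N) ℂ)
    (a b : EuclideanSpace ℝ (Fin N)) :
    ‖conjDiag U a - conjDiag V b‖ ^ 2 =
      ∑ i, ∑ j, ‖((star U * V : Matrix.unitaryGroup (Fin N) ℂ) : Matrix (Fin N) (Fin N) ℂ) i j‖ ^ 2
        * (a i - b j) ^ 2 := by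
  have hU : star (U : Matrix (Fin N) (Fin N) ℂ) * U = 1 := Unitary.coe_star_mul_self U
  have hV : star (V : Matrix (Fin N) (Fin N) ℂ) * V = 1 := Unitary.coe_star_mul_self V
  rw [HermMat.norm_eq, ← Matrix.frobenius_norm_unitary_mul_mul (star U) V,
    Matrix.frobenius_norm_sq_eq_sum]
  have h : ((star U : Matrix.unitaryGroup (Fin N) ℂ) : Matrix (Fin N) (Fin N) ℂ) *
      ((conjDiag U a - conjDiag V b : HermMat N) : Matrix (Fin N) (Fin N) ℂ) * V =
      Matrix.diagonal (fun i => ((a i : ℝ) : ℂ)) *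
        ((star U * V : Matrix.unitaryGroup (Fin N) ℂ) : Matrix (Fin N) (Fin N) ℂ) -
      ((star U * V : Matrix.unitaryGroup (Fin N) ℂ) : Matrix (Fin N) (Fin N) ℂ) *
        Matrix.diagonal (fun i => ((b i : ℝ) : ℂ)) := by
    simp only [AddSubgroup.coe_sub, conjDiag, mul_sub, sub_mul]
    simp only [Matrix.UnitaryGroup.mul_val, Unitary.coe_star]
    congr 1
    · simp only [← mul_assoc]
      rw [hU, one_mul]
    · simp only [mul_assoc]
      rw [hV, mul_one]
  rw [h]
  refine Finset.sum_congr rfl fun i _ => Finset.sum_congr rfl fun j _ => ?_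
  rw [Matrix.sub_apply, Matrix.diagonal_mul, Matrix.mul_diagonal, mul_comm, ← mul_sub, norm_mul,
    mul_pow, ← Complex.ofReal_sub, Complex.norm_real, Real.norm_eq_abs, sq_abs]

theorem norm_conjDiag_sub_conjDiag (U : Matrix.unitaryGroup (Fin N) ℂ)
    (a b : EuclideanSpace ℝ (Fin N)) : ‖conjDiag U a - conjDiag U b‖ = ‖a - b‖ := by
  refine (sq_eq_sq₀ (norm_nonneg _) (norm_nonneg _)).1 ?_
  rw [norm_conjDiag_sub_conjDiag_sq, EuclideanSpace.norm_sq_eq]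
  refine Finset.sum_congr rfl fun i _ => ?_
  rw [Finset.sum_eq_single i (fun j _ hj => by simp [Matrix.one_apply_ne hj.symm]) (by simp)]
  simp

theorem eigvals_antitone (X : HermMat N) : Antitone (eigvals X) := fun i j hij =>
  Matrix.IsHermitian.eigenvalues₀_antitone (A := (X : Matrix (Fin N) (Fin N) ℂ)) X.2 (by simpa using hij)

theorem eigvals_map (X : HermMat N) :
    (X : Matrix (Fin N) (Fin N) ℂ).charpoly.roots =
      (Finset.univ.val : Multiset (Fin N)).map fun i => ((eigvals X i : ℝ) : ℂ) := by
  rw [Matrix.IsHermitian.roots_charpoly_eq_eigenvalues₀ (A := (X : Matrix (Fin N) (Fin N) ℂ)) X.2]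
  have h := Multiset.map_univ_val_equiv (finCongr (Fintype.card_fin N).symm)
  rw [← h, Multiset.map_map]
  rfl

theorem exists_perm_of_map_univ_eq {α : Type*} [LinearOrder α] {a b : Fin N → α}
    (h : (Finset.univ.val : Multiset (Fin N)).map a = Finset.univ.val.map b) :
    ∃ σ : Equiv.Perm (Fin N), a = b ∘ σ := by
  have hs : List.ofFn (a ∘ Tuple.sort a) = List.ofFn (b ∘ Tuple.sort b) := by
    refine List.Perm.eq_of_sortedLE (Tuple.monotone_sort a).sortedLE_ofFn
      (Tuple.monotone_sort b).sortedLE_ofFn ?_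
    refine (Equiv.Perm.ofFn_comp_perm _ _).trans (.trans ?_ (Equiv.Perm.ofFn_comp_perm _ _).symm)
    simpa only [Fin.univ_val_map, Multiset.coe_eq_coe] using h
  have hs' := List.ofFn_injective hs
  refine ⟨(Tuple.sort a).symm.trans (Tuple.sort b), funext fun i => ?_⟩
  simpa using congrFun hs' ((Tuple.sort a).symm i)

theorem exists_perm_eigvals_conjDiag (U : Matrix.unitaryGroup (Fin N) ℂ)
    (v : EuclideanSpace ℝ (Fin N)) :
    ∃ σ : Equiv.Perm (Fin N), eigvals (conjDiag U v) = WithLp.toLp 2 fun i => v (σ i) := by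
  have hU : star (U : Matrix (Fin N) (Fin N) ℂ) * U = 1 := Unitary.coe_star_mul_self U
  have h : (conjDiag U v : Matrix (Fin N) (Fin N) ℂ).charpoly.roots =
      (Finset.univ.val : Multiset (Fin N)).map fun i => ((v i : ℝ) : ℂ) := by
    rw [conjDiag, Matrix.charpoly_mul_comm, ← mul_assoc, hU, one_mul, Matrix.charpoly_diagonal,
      Polynomial.roots_prod _ _ (by simp [Finset.prod_ne_zero_iff, Polynomial.X_sub_C_ne_zero])]
    simp
  rw [eigvals_map] at h
  -- Real parts bring the roots into a linear order, where sorting yields the permutation.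
  have h' := congrArg (Multiset.map Complex.re) h
  simp only [Multiset.map_map, Function.comp_def, Complex.ofReal_re] at h'
  obtain ⟨σ, hσ⟩ := exists_perm_of_map_univ_eq h'
  exact ⟨σ, PiLp.ext fun i => congrFun hσ i⟩

/-- Permuting the columns of `U` compensates for permuting the diagonal. -/
theorem exists_conjDiag_comp_perm (U : Matrix.unitaryGroup (Fin N) ℂ) (σ : Equiv.Perm (Fin N)) :
    ∃ V : Matrix.unitaryGroup (Fin N) ℂ, ∀ v : EuclideanSpace ℝ (Fin N),
      conjDiag U (WithLp.toLp 2 fun i => v (σ i)) = conjDiag V v := by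
  have hsub : ∀ M : Matrix (Fin N) (Fin N) ℂ, star (M.submatrix id σ.symm) =
      (star M).submatrix σ.symm id := fun M => rfl
  refine ⟨⟨(U : Matrix (Fin N) (Fin N) ℂ).submatrix id σ.symm, ?_⟩, fun v => Subtype.ext ?_⟩
  · rw [Matrix.mem_unitaryGroup_iff, hsub]
    rw [Matrix.submatrix_mul_equiv, Matrix.submatrix_id_id]
    exact Unitary.coe_mul_star_self U
  · simp only [conjDiag, hsub]
    have hd : Matrix.diagonal (fun i => ((v i : ℝ) : ℂ)) =
        (Matrix.diagonal (fun i => ((v (σ i) : ℝ) : ℂ))).submatrix σ.symm σ.symm := by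
      rw [Matrix.submatrix_diagonal_equiv]
      simp [Function.comp_def]
    rw [hd, Matrix.submatrix_mul_equiv, Matrix.submatrix_mul_equiv, Matrix.submatrix_id_id]

/-- The spectral theorem, with the eigenvalues in non-increasing order. -/
theorem exists_eq_conjDiag_eigvals (X : HermMat N) :
    ∃ U : Matrix.unitaryGroup (Fin N) ℂ, X = conjDiag U (eigvals X) := by
  have hX : (X : Matrix (Fin N) (Fin N) ℂ).IsHermitian := X.2
  obtain ⟨V, hV⟩ := exists_conjDiag_comp_perm hX.eigenvectorUnitary
    ((Fintype.equivOfCardEq (Fintype.card_fin _)).symm.trans (finCongr (Fintype.card_fin N)))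
  refine ⟨V, ?_⟩
  rw [← hV]
  refine Subtype.ext ?_
  conv_lhs => rw [hX.spectral_theorem, Unitary.conjStarAlgAut_apply]
  rfl

/-! ### Rearrangement, Birkhoff's theorem and Hoffman–Wielandt -/

theorem sum_sq_sub_le_sum_sq_sub_comp_perm {a b : Fin N → ℝ} (ha : Antitone a) (hb : Antitone b)
    (σ : Equiv.Perm (Fin N)) : ∑ i, (a i - b i) ^ 2 ≤ ∑ i, (a i - b (σ i)) ^ 2 := by
  have h := (ha.monovary hb).sum_mul_comp_perm_le_sum_mul (σ := σ)
  have hs : ∑ i, b (σ i) ^ 2 = ∑ i, b i ^ 2 := Equiv.sum_comp σ fun i => b i ^ 2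
  simp only [sub_sq, Finset.sum_add_distrib, Finset.sum_sub_distrib, mul_assoc,
    ← Finset.mul_sum, hs]
  linarith

theorem normSq_mem_doublyStochastic (W : Matrix.unitaryGroup (Fin N) ℂ) :
    (Matrix.of fun i j => ‖(W : Matrix (Fin N) (Fin N) ℂ) i j‖ ^ 2) ∈
      doublyStochastic ℝ (Fin N) := by
  rw [mem_doublyStochastic_iff_sum]
  refine ⟨fun i j => by simp only [Matrix.of_apply]; positivity, fun i => ?_, fun j => ?_⟩
  · have hW : (W : Matrix (Fin N) (Fin N) ℂ) * star (W : Matrix (Fin N) (Fin N) ℂ) = 1 :=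
      Unitary.coe_mul_star_self W
    have h := congrArg (fun A : Matrix (Fin N) (Fin N) ℂ => A i i) hW
    simp only [Matrix.mul_apply, Matrix.one_apply_eq, Matrix.star_apply, RCLike.star_def,
      Complex.mul_conj'] at h
    simp only [Matrix.of_apply]
    exact_mod_cast h
  · have hW : star (W : Matrix (Fin N) (Fin N) ℂ) * (W : Matrix (Fin N) (Fin N) ℂ) = 1 :=
      Unitary.coe_star_mul_self W
    have h := congrArg (fun A : Matrix (Fin N) (Fin N) ℂ => A j j) hW
    simp only [Matrix.mul_apply, Matrix.one_apply_eq, Matrix.star_apply, RCLike.star_def,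
      Complex.conj_mul'] at h
    simp only [Matrix.of_apply]
    exact_mod_cast h

/-- The right-hand side is linear in `M`, so Birkhoff's theorem reduces it to permutation matrices,
where the rearrangement inequality applies. -/
theorem sum_sq_sub_le_of_mem_doublyStochastic {a b : Fin N → ℝ} (ha : Antitone a)
    (hb : Antitone b) {M : Matrix (Fin N) (Fin N) ℝ} (hM : M ∈ doublyStochastic ℝ (Fin N)) :
    ∑ i, (a i - b i) ^ 2 ≤ ∑ i, ∑ j, M i j * (a i - b j) ^ 2 := by
  obtain ⟨w, hw0, hw1, rfl⟩ := exists_eq_sum_perm_of_mem_doublyStochastic hM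
  have h : ∑ i, ∑ j, (∑ σ : Equiv.Perm (Fin N), w σ • σ.permMatrix ℝ) i j * (a i - b j) ^ 2 =
      ∑ σ : Equiv.Perm (Fin N), w σ * ∑ i, (a i - b (σ i)) ^ 2 := by
    simp only [Matrix.sum_apply, Finset.sum_mul, Finset.mul_sum]
    rw [Finset.sum_comm (s := (Finset.univ : Finset (Equiv.Perm (Fin N))))]
    refine Finset.sum_congr rfl fun i _ => ?_
    rw [Finset.sum_comm]
    refine Finset.sum_congr rfl fun σ _ => ?_
    rw [Finset.sum_eq_single (σ i)]
    · simp [PEquiv.toMatrix_apply, Equiv.toPEquiv_apply]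
    · intro j _ hj
      simp [PEquiv.toMatrix_apply, Equiv.toPEquiv_apply, hj.symm]
    · simp
  rw [h]
  calc ∑ i, (a i - b i) ^ 2
      = ∑ σ : Equiv.Perm (Fin N), w σ * ∑ i, (a i - b i) ^ 2 := by
        rw [← Finset.sum_mul, hw1, one_mul]
    _ ≤ _ := Finset.sum_le_sum fun σ _ => mul_le_mul_of_nonneg_left
        (sum_sq_sub_le_sum_sq_sub_comp_perm ha hb σ) (hw0 σ)

/-- The **Hoffman–Wielandt inequality** for Hermitian matrices. -/
theorem norm_eigvals_sub_eigvals_le (X Y : HermMat N) : ‖eigvals X - eigvals Y‖ ≤ ‖X - Y‖ := by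
  obtain ⟨U, hU⟩ := exists_eq_conjDiag_eigvals X
  obtain ⟨V, hV⟩ := exists_eq_conjDiag_eigvals Y
  refine (sq_le_sq₀ (norm_nonneg _) (norm_nonneg _)).1 ?_
  conv_rhs => rw [hU, hV, norm_conjDiag_sub_conjDiag_sq]
  rw [EuclideanSpace.norm_sq_eq]
  simpa using sum_sq_sub_le_of_mem_doublyStochastic (eigvals_antitone X) (eigvals_antitone Y)
    (normSq_mem_doublyStochastic (star U * V))

end Spectral

/-! ### Spectral functions -/

section SpectralFunction

variable {N : ℕ} {γ : ℝ}

theorem norm_toLp_comp_perm_sub (σ : Equiv.Perm (Fin N)) (x y : EuclideanSpace ℝ (Fin N)) :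
    ‖(WithLp.toLp 2 fun i => x (σ i) : EuclideanSpace ℝ (Fin N)) - y‖ =
      ‖x - WithLp.toLp 2 fun i => y (σ.symm i)‖ := by
  rw [EuclideanSpace.norm_eq, EuclideanSpace.norm_eq]
  congr 1
  rw [← Equiv.sum_comp σ fun i => ‖(x - WithLp.toLp 2 fun i => y (σ.symm i) :
    EuclideanSpace ℝ (Fin N)) i‖ ^ 2]
  simp

theorem quadratic_le_comp_perm {f : EuclideanSpace ℝ (Fin N) → ℝ≥0∞} (hf : IsSymmetricFun f)
    {α : ℝ} {y : EuclideanSpace ℝ (Fin N)}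
    (h : ∀ z, ((α - γ / 2 * ‖z - y‖ ^ 2 : ℝ) : EReal) ≤ f z) (σ : Equiv.Perm (Fin N))
    (z : EuclideanSpace ℝ (Fin N)) :
    ((α - γ / 2 * ‖z - WithLp.toLp 2 fun i => y (σ i)‖ ^ 2 : ℝ) : EReal) ≤ f z := by
  have h1 := h (WithLp.toLp 2 fun i => z (σ.symm i))
  rw [norm_toLp_comp_perm_sub, hf] at h1
  exact h1

theorem quadraticEnvelope_comp_perm {f : EuclideanSpace ℝ (Fin N) → ℝ≥0∞}
    (hf : IsSymmetricFun f) (σ : Equiv.Perm (Fin N)) (x : EuclideanSpace ℝ (Fin N)) :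
    quadraticEnvelope γ (fun x => (f x : EReal)) (WithLp.toLp 2 fun i => x (σ i)) =
      quadraticEnvelope γ (fun x => (f x : EReal)) x := by
  have key : ∀ (σ : Equiv.Perm (Fin N)) (x : EuclideanSpace ℝ (Fin N)),
      quadraticEnvelope γ (fun x => (f x : EReal)) (WithLp.toLp 2 fun i => x (σ i)) ≤
        quadraticEnvelope γ (fun x => (f x : EReal)) x := by
    refine fun σ x => quadraticEnvelope_le_iff.2 fun α y h => ?_
    rw [norm_toLp_comp_perm_sub]
    exact le_quadraticEnvelope (f := fun x => (f x : EReal)) (quadratic_le_comp_perm hf h σ.symm) x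
  refine le_antisymm (key σ x) ?_
  simpa using key σ.symm (WithLp.toLp 2 fun i => x (σ i))

theorem quadraticEnvelope_comp_eigvals {f : EuclideanSpace ℝ (Fin N) → ℝ≥0∞}
    (hf : IsSymmetricFun f) (hγ : 0 ≤ γ) (X : HermMat N) :
    quadraticEnvelope γ (fun X => (f (eigvals X) : EReal)) X =
      quadraticEnvelope γ (fun x => (f x : EReal)) (eigvals X) := by
  have hmono : ∀ (α s t : ℝ), 0 ≤ s → s ≤ t →
      ((α - γ / 2 * t ^ 2 : ℝ) : EReal) ≤ ((α - γ / 2 * s ^ 2 : ℝ) : EReal) := by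
    intro α s t hs hst
    rw [EReal.coe_le_coe_iff]
    gcongr
  refine le_antisymm (quadraticEnvelope_le_iff.2 fun α Y h => ?_)
    (quadraticEnvelope_le_iff.2 fun α y h => ?_)
  · refine (hmono α _ _ (norm_nonneg _) (norm_eigvals_sub_eigvals_le X Y)).trans
      (le_quadraticEnvelope (f := fun x => (f x : EReal)) (fun z => ?_) _)
    -- Testing the minorant of `F` on matrices diagonalized by the same `V` as its center turns
    -- matrix distances into vector distances.
    obtain ⟨V, hV⟩ := exists_eq_conjDiag_eigvals Y
    obtain ⟨σ, hσ⟩ := exists_perm_eigvals_conjDiag V z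
    have h1 := h (conjDiag V z)
    rw [hσ, hf] at h1
    nth_rewrite 1 [hV] at h1
    rwa [norm_conjDiag_sub_conjDiag] at h1
  -- The center `conjDiag U y` keeps the value at `X` exact; at other matrices Hoffman–Wielandt only
  -- lowers the quadratic.
  · obtain ⟨U, hU⟩ := exists_eq_conjDiag_eigvals X
    obtain ⟨σ, hσ⟩ := exists_perm_eigvals_conjDiag U y
    rw [← norm_conjDiag_sub_conjDiag U, ← hU]
    refine le_quadraticEnvelope (f := fun X => (f (eigvals X) : EReal)) (fun Z => ?_) X
    refine (hmono α _ _ (norm_nonneg _) (norm_eigvals_sub_eigvals_le Z _)).trans ?_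
    rw [hσ]
    exact quadratic_le_comp_perm hf h σ (eigvals Z)

theorem conjDiag_mem_prox {g : EuclideanSpace ℝ (Fin N) → EReal}
    (hg : ∀ (σ : Equiv.Perm (Fin N)) x, g (WithLp.toLp 2 fun i => x (σ i)) = g x)
    {X : HermMat N} {U : Matrix.unitaryGroup (Fin N) ℂ} (hU : X = conjDiag U (eigvals X))
    {v : EuclideanSpace ℝ (Fin N)} (hv : v ∈ prox g (eigvals X)) :
    conjDiag U v ∈ prox (fun Y => g (eigvals Y)) X := by
  intro Y
  obtain ⟨σ, hσ⟩ := exists_perm_eigvals_conjDiag U v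
  have h1 : ‖conjDiag U v - X‖ = ‖v - eigvals X‖ := by
    nth_rewrite 1 [hU]
    exact norm_conjDiag_sub_conjDiag U v _
  simp only [hσ, hg, h1]
  refine (hv (eigvals Y)).trans (add_le_add le_rfl ?_)
  rw [EReal.coe_le_coe_iff]
  have := norm_eigvals_sub_eigvals_le Y X
  gcongr

end SpectralFunction

theorem proposition1 (N : ℕ) (f : EuclideanSpace ℝ (Fin N) → ℝ≥0∞) (hf : IsSymmetricFun f)
    (F : HermMat N → ℝ≥0∞) (hF : ∀ X : HermMat N, F X = f (eigvals X))
    (γ : ℝ) (hγ : 0 ≤ γ) :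
    (quadraticEnvelope γ (fun X => (F X : EReal)) =
      quadraticEnvelope γ (fun x => (f x : EReal)) ∘ eigvals) ∧
    ((∃ x, f x ≠ ∞) → ∀ ρ : ℝ, γ < ρ → ∀ X : HermMat N,
      (∃! v, v ∈ prox (fun x => quadraticEnvelope γ (fun x => (f x : EReal)) x / (ρ : EReal))
        (eigvals X)) ∧
      ∀ U : Matrix.unitaryGroup (Fin N) ℂ, X = conjDiag U (eigvals X) →
        prox (fun Y => quadraticEnvelope γ (fun Y => (F Y : EReal)) Y / (ρ : EReal)) X =
          conjDiag U ''
            prox (fun x => quadraticEnvelope γ (fun x => (f x : EReal)) x / (ρ : EReal))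
              (eigvals X)) := by
  obtain rfl : F = fun X => f (eigvals X) := funext hF
  refine ⟨funext fun X => quadraticEnvelope_comp_eigvals hf hγ X, ?_⟩
  rintro ⟨x₀, hx₀⟩ ρ hρ X
  have hx₀' : (f x₀ : EReal) ≠ ⊤ := EReal.coe_ennreal_eq_top_iff.not.2 hx₀
  obtain ⟨v, hv⟩ := exists_mem_prox_quadraticEnvelope (f := fun x => (f x : EReal)) hγ
    (fun x => EReal.coe_ennreal_nonneg _) hx₀' (hγ.trans_lt hρ) (eigvals X)
  have hsub := prox_quadraticEnvelope_subsingleton (f := fun x => (f x : EReal))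
    (fun x y => by
      have := parallelogram_law_with_norm ℝ x y
      linarith) hγ (fun x => EReal.coe_ennreal_nonneg _) hx₀' hρ (eigvals X)
  refine ⟨⟨v, hv, fun u hu => hsub hu hv⟩, fun U hU => ?_⟩
  have hmem : conjDiag U v ∈ prox (fun Y =>
      quadraticEnvelope γ (fun Y : HermMat N => (f (eigvals Y) : EReal)) Y / (ρ : EReal)) X := by
    have h := conjDiag_mem_prox
      (g := fun x => quadraticEnvelope γ (fun x => (f x : EReal)) x / (ρ : EReal))
      (fun σ x => by simp only [quadraticEnvelope_comp_perm hf]) hU hv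
    simpa only [quadraticEnvelope_comp_eigvals hf hγ] using h
  -- Uniqueness on matrices needs `F` to be finite somewhere.
  have hfin : (f (eigvals (conjDiag U x₀)) : EReal) ≠ ⊤ := by
    obtain ⟨σ, hσ⟩ := exists_perm_eigvals_conjDiag U x₀
    rwa [hσ, hf]
  have hsubF := prox_quadraticEnvelope_subsingleton
    (f := fun Y : HermMat N => (f (eigvals Y) : EReal)) HermMat.parallelogram hγ
    (fun x => EReal.coe_ennreal_nonneg _) hfin hρ X
  rw [hsub.eq_singleton_of_mem hv, Set.image_singleton]
  exact hsubF.eq_singleton_of_mem hmem
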